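/- **Proposition (Reciprocals of products of polynomial values).** Let $m\ge 3$ be an integer and let $D\subset\{0,1,\dots,m-1\}$ satisfy $1<\#D<m$. Let $$K_{m,D}:=\left\{\sum_{j=1}^\infty \frac{a_j}{m^j} : a_j\in D\text{ for all } j\ge 1\right\}\subset[0,1]$$ be the associated missing-digit set. Let $f\in\mathbb{Z}[x]$ be a nonconstant polynomial (of degree $d\ge 1$) such that $f(k)>0$ for all integers $k\ge 1$, and put $$a_n:=\prod_{k=1}^n f(k)\qquad(n\ge 1).$$ Then the set $$\left\{\frac{1}{a_n} : n\ge 1\right\}\cap K_{m,D}$$ is finite. -/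

import Mathlib

/-- The missing-digit set `K_{m,D}`: the reals `∑_{j ≥ 1} a_j / m ^ j` with every digit `a_j` in `D`
(the sum is indexed from `0` here, so the digit `a_{j+1}` of the usual notation is `a j`). -/
def missingDigitSet (m : ℕ) (D : Finset ℕ) : Set ℝ :=
  {x : ℝ | ∃ a : ℕ → ℕ, (∀ j, a j ∈ D) ∧ HasSum (fun j : ℕ => (a j : ℝ) / (m : ℝ) ^ (j + 1)) x}

/-- The product `f(1) f(2) ⋯ f(n)` of consecutive values of an integer polynomial. -/
def polyProd (f : Polynomial ℤ) (n : ℕ) : ℤ :=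
  ∏ k ∈ Finset.Icc 1 n, f.eval (k : ℤ)

/-! Multiplying a point of `K_{m,D}` by powers of `m` never lands, mod 1, in the open gap of length
`1/m` given by a missing digit. It suffices that the orbit of `1/a` meets every such gap when `a =
a_n`, `n` large. Fix a prime `p ∤ m` dividing some value of `f`; then `p ^ E ∣ a_n` with `E` of
order `n/p`, while all prime factors of `a_n` are `O(n ^ deg f)`, far below `p ^ E`. So the rest of
`a` contributes few factors `p` to the order of `m`. Hence some power `A` of `m` is trivial modulo
`Q = a / p ^ b`, up to factors shared with `m`, yet has order `p ^ b` modulo the `p`-part of `a`.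
The orbit thus contains a full coset of `(1/p ^ b)ℤ` mod 1, which meets the gap once `p ^ b > m`
(`one_div_notMem_missingDigitSet`). -/

theorem missingDigitSet_subset_Icc {m : ℕ} (hm : 2 ≤ m) {D : Finset ℕ} (hD : D ⊆ Finset.range m)
    {x : ℝ} (hx : x ∈ missingDigitSet m D) : 0 ≤ x ∧ x ≤ 1 := by
  obtain ⟨a, ha, hs⟩ := hx
  have hm' : (2 : ℝ) ≤ m := by exact_mod_cast hm
  refine ⟨hs.nonneg fun j => by positivity, ?_⟩
  have h1 : HasSum (fun j : ℕ => ((m : ℝ) - 1) / (m : ℝ) * ((m : ℝ)⁻¹) ^ j) 1 := by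
    have h := (hasSum_geometric_of_lt_one (r := (m : ℝ)⁻¹) (by positivity)
      (inv_lt_one_of_one_lt₀ (by linarith))).mul_left (((m : ℝ) - 1) / (m : ℝ))
    have h2 : (m : ℝ) - 1 ≠ 0 := by linarith
    have h3 : 1 - (m : ℝ)⁻¹ = (m - 1) / m := by field_simp
    rwa [h3, mul_inv_cancel₀ (div_ne_zero h2 (by positivity))] at h
  refine hasSum_le (fun j => ?_) hs h1
  have h3 : a j + 1 ≤ m := Finset.mem_range.1 (hD (ha j))
  have h4 : (a j : ℝ) ≤ m - 1 := by
    have : (a j : ℝ) + 1 ≤ m := by exact_mod_cast h3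
    linarith
  rw [inv_pow, ← div_eq_mul_inv, div_div, ← pow_succ']
  gcongr

theorem exists_digit_of_mem_missingDigitSet {m : ℕ} (hm : 2 ≤ m) {D : Finset ℕ} {x : ℝ}
    (hx : x ∈ missingDigitSet m D) :
    ∃ a ∈ D, ∃ y ∈ missingDigitSet m D, (m : ℝ) * x = a + y := by
  obtain ⟨a, ha, hs⟩ := hx
  have hm0 : (m : ℝ) ≠ 0 := by positivity
  refine ⟨a 0, ha 0, m * x - a 0, ⟨fun j => a (j + 1), fun j => ha _, ?_⟩, by ring⟩
  have h := (hasSum_nat_add_iff' 1).2 (hs.mul_left (m : ℝ))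
  rw [Finset.sum_range_one, zero_add, pow_one, mul_div_cancel₀ _ hm0] at h
  refine h.congr_fun fun j => ?_
  rw [pow_succ (m : ℝ) (j + 1)]
  field_simp

theorem exists_orbit_mem_missingDigitSet {m : ℕ} (hm : 2 ≤ m) {D : Finset ℕ} {x : ℝ}
    (hx : x ∈ missingDigitSet m D) (k : ℕ) :
    ∃ z : ℤ, ∃ y ∈ missingDigitSet m D, (m : ℝ) ^ k * x = z + y := by
  induction k with
  | zero => exact ⟨0, x, hx, by simp⟩
  | succ k ih =>
    obtain ⟨z, y, hy, h⟩ := ih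
    obtain ⟨a, -, y', hy', h'⟩ := exists_digit_of_mem_missingDigitSet hm hy
    refine ⟨m * z + a, y', hy', ?_⟩
    rw [pow_succ', mul_assoc, h, mul_add, h']
    push_cast
    ring

/-- The orbit of a point of `K_{m,D}` under multiplication by `m` avoids, modulo one, the open
interval of numbers whose first digit is a missing digit. -/
theorem orbit_avoids_gap {m : ℕ} (hm : 2 ≤ m) {D : Finset ℕ} (hD : D ⊆ Finset.range m) {x : ℝ}
    (hx : x ∈ missingDigitSet m D) {d : ℕ} (hdm : d < m) (hd : d ∉ D) (k : ℕ) (z : ℤ) {y : ℝ}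
    (hy : (m : ℝ) ^ k * x = z + y) (h1 : (d : ℝ) / m < y) (h2 : y < (d + 1) / m) : False := by
  obtain ⟨z', y', hy', h⟩ := exists_orbit_mem_missingDigitSet hm hx k
  obtain ⟨a, ha, t, ht, hat⟩ := exists_digit_of_mem_missingDigitSet hm hy'
  obtain ⟨ht0, ht1⟩ := missingDigitSet_subset_Icc hm hD ht
  have ham : a < m := Finset.mem_range.1 (hD ha)
  have hm0 : (0 : ℝ) < m := by positivity
  rw [div_lt_iff₀ hm0] at h1
  rw [lt_div_iff₀ hm0] at h2
  have key : (m : ℝ) * (z - z') + y * m = a + t := by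
    rw [← hat, show y' = z + y - z' by linarith]
    ring
  -- Since `y * m` lies strictly inside `(d, d + 1)`, even a tail `t = 1` leaves the integers `a`
  -- and `m * (z - z') + d` less than 1 apart.
  have l1 : (m : ℤ) * (z - z') + d < a + 1 := by
    have : (m : ℝ) * (z - z') + d < a + 1 := by linarith
    exact_mod_cast this
  have l2 : (a : ℤ) < m * (z - z') + d + 1 := by
    have : (a : ℝ) < m * (z - z') + d + 1 := by linarith
    exact_mod_cast this
  have l3 : z - z' = 0 := by
    rcases lt_trichotomy (z - z') 0 with h0 | h0 | h0
    · nlinarith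
    · exact h0
    · nlinarith
  rw [l3] at l1 l2
  exact hd ((show a = d by omega) ▸ ha)

/-! ### Valuations and the orbit of a reciprocal -/

/-- Lifting the exponent; the square in `p ^ 2 ∣ x - 1` is what makes `p = 2` behave like odd
primes. -/
theorem padicValNat_pow_sub_one {p : ℕ} [hp : Fact p.Prime] {x n : ℕ} (hx : 1 < x)
    (hpx : p ^ 2 ∣ x - 1) (hn : n ≠ 0) :
    padicValNat p (x ^ n - 1) = padicValNat p (x - 1) + padicValNat p n := by
  have hp1 : p ∣ x - 1 := (dvd_pow_self p two_ne_zero).trans hpx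
  have hpx' : ¬ p ∣ x := fun h => hp.out.one_lt.ne' (Nat.dvd_one.1 (by
    simpa [Nat.sub_sub_self hx.le] using Nat.dvd_sub h hp1))
  rcases hp.out.eq_two_or_odd' with rfl | hodd
  · have h4 : (4 : ℤ) ∣ (x : ℤ) - 1 := by
      have := Int.natCast_dvd_natCast.2 hpx
      rwa [Nat.cast_sub hx.le] at this
    have h := Int.two_pow_sub_pow' n h4 (by exact_mod_cast hpx')
    rw [one_pow] at h
    have hpow : 1 < x ^ n := Nat.one_lt_pow hn hx
    rw [← Nat.cast_inj (R := ℕ∞), Nat.cast_add, padicValNat_eq_emultiplicity (by omega),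
      padicValNat_eq_emultiplicity (by omega), padicValNat_eq_emultiplicity hn,
      ← Int.natCast_emultiplicity, ← Int.natCast_emultiplicity, ← Int.natCast_emultiplicity,
      Nat.cast_sub hx.le, Nat.cast_sub hpow.le]
    exact_mod_cast h
  · simpa using padicValNat.pow_sub_pow (p := p) hodd hx hp1 hpx' hn

/-- If `M A ^ j`, for `j < r`, are distinct modulo `r Q` and all congruent to `M` modulo `Q`, then
they meet every residue class modulo `r Q` in the class of `M` modulo `Q`. -/
theorem exists_pow_eq_of_injective {r Q : ℕ} {M A : ℤ} (hr : 0 < r)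
    (h1 : ∀ j : ℕ, (Q : ℤ) ∣ M * A ^ j - M)
    (h2 : ∀ i j : ℕ, i < j → j < r → ¬ ((r * Q : ℕ) : ℤ) ∣ M * A ^ j - M * A ^ i) (t : ℤ) :
    ∃ j : ℕ, ∃ z : ℤ, M * A ^ j = M + Q * t + r * Q * z := by
  have : NeZero r := ⟨hr.ne'⟩
  choose w hw using h1
  have hdiff : ∀ i j : Fin r, i < j → (w i : ZMod r) ≠ w j := by
    intro i j hij h
    rw [ZMod.intCast_eq_intCast_iff_dvd_sub] at h
    refine h2 i j hij j.2 ?_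
    have : M * A ^ (j : ℕ) - M * A ^ (i : ℕ) = (w j - w i) * Q := by
      linear_combination hw j - hw i
    rw [this, Nat.cast_mul]
    exact mul_dvd_mul_right h _
  have hinj : Function.Injective fun j : Fin r => (w j : ZMod r) := by
    intro i j h
    rcases lt_trichotomy i j with hij | hij | hij
    · exact (hdiff i j hij h).elim
    · exact hij
    · exact (hdiff j i hij h.symm).elim
  obtain ⟨j, hj⟩ := ((Fintype.bijective_iff_injective_and_card _).2
    ⟨hinj, by simp [ZMod.card]⟩).2 (t : ZMod r)
  obtain ⟨z, hz⟩ := (ZMod.intCast_eq_intCast_iff_dvd_sub _ _ _).1 hj.symm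
  exact ⟨j, z, by linear_combination hw j + Q * hz⟩

/-- Primes `l ∣ m` are absorbed by `m ^ K`. For the others Euler's theorem applies: the `p`-part of
`φ(l ^ k)` is that of `l - 1`, hence at most `p ^ g`, and its `p`-free part divides that of `φ(u)`.
-/
theorem dvd_pow_mul_pow_sub_one {m p g u K : ℕ} [hp : Fact p.Prime] (hu : u ≠ 0) (hpu : ¬ p ∣ u)
    (hK : u ≤ K) (hl : ∀ l : ℕ, l.Prime → l ∣ u → l ≤ p ^ g) (s : ℕ) :
    u ∣ m ^ K * (m ^ (s * (p ^ g * (u.totient / p ^ u.totient.factorization p))) - 1) := by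
  refine (Nat.dvd_iff_prime_pow_dvd_dvd _ _).2 fun l k hlp hlk => ?_
  rcases Nat.eq_zero_or_pos k with rfl | hk
  · simp
  have hlu : l ∣ u := (dvd_pow_self l hk.ne').trans hlk
  by_cases hlm : l ∣ m
  · refine Dvd.dvd.mul_right ((pow_dvd_pow_of_dvd hlm k).trans (pow_dvd_pow m ?_)) _
    exact ((Nat.lt_pow_self hlp.one_lt).le.trans (Nat.le_of_dvd (Nat.pos_of_ne_zero hu) hlk)).trans hK
  refine Dvd.dvd.mul_left ?_ _
  have hcop : Nat.Coprime m (l ^ k) := ((hlp.coprime_iff_not_dvd.2 hlm).symm).pow_right k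
  have hpl : ¬ p ∣ l := fun h => hpu (h.trans hlu)
  have hphi : (l ^ k).totient ∣ p ^ g * (u.totient / p ^ u.totient.factorization p) := by
    rw [← Nat.ordProj_mul_ordCompl_eq_self (l ^ k).totient p]
    refine mul_dvd_mul (pow_dvd_pow p ?_)
      (Nat.ordCompl_dvd_ordCompl_of_dvd (Nat.totient_dvd_of_dvd hlk) p)
    have hl1 : l - 1 ≠ 0 := by have := hlp.two_le; omega
    have h0 : (l ^ (k - 1)).factorization p = 0 :=
      Nat.factorization_eq_zero_of_not_dvd fun h => hpl (hp.out.dvd_of_dvd_pow h)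
    rw [Nat.totient_prime_pow hlp hk, Nat.factorization_mul (pow_ne_zero _ hlp.ne_zero) hl1,
      Finsupp.add_apply, h0, zero_add]
    refine (Nat.pow_le_pow_iff_right hp.out.one_lt).1 ?_
    exact (Nat.le_of_dvd (Nat.pos_of_ne_zero hl1) (Nat.ordProj_dvd _ _)).trans
      ((Nat.sub_le _ _).trans (hl l hlp hlu))
  obtain ⟨c, hc⟩ := hphi
  have h1 : m ^ (s * (p ^ g * (u.totient / p ^ u.totient.factorization p))) ≡ 1 [MOD l ^ k] := by
    rw [hc, show s * ((l ^ k).totient * c) = (l ^ k).totient * (s * c) by ring, pow_mul]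
    simpa using (Nat.ModEq.pow_totient hcop).pow (s * c)
  have hm0 : 0 < m := Nat.pos_of_ne_zero fun h => hlm (h ▸ dvd_zero l)
  exact (Nat.modEq_iff_dvd' (Nat.pos_of_ne_zero (pow_ne_zero _ hm0.ne'))).1 h1.symm

/-- A reciprocal `1 / a` does not lie in `K_{m,D}` if `a` is divisible by a power of a prime `p ∤ m`
that is large compared with all prime factors of `a`. -/
theorem one_div_notMem_missingDigitSet {m : ℕ} (hm : 2 ≤ m) {D : Finset ℕ}
    (hD : D ⊆ Finset.range m) (hDm : D.card < m) {p : ℕ} [hp : Fact p.Prime] (hpm : ¬ p ∣ m)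
    {a b : ℕ} (ha : a ≠ 0) (hb : m < p ^ b)
    (hv : b + padicValNat p (m ^ (p * (p - 1)) - 1) ≤ padicValNat p a)
    (hl : ∀ l : ℕ, l.Prime → l ∣ a →
      l ≤ p ^ (padicValNat p a - (b + padicValNat p (m ^ (p * (p - 1)) - 1)))) :
    1 / (a : ℝ) ∉ missingDigitSet m D := by
  intro hmem
  obtain ⟨d, hd, hdD⟩ : ∃ d ∈ Finset.range m, d ∉ D := by
    by_contra! h
    have := Finset.card_le_card (s := Finset.range m) (t := D) h
    rw [Finset.card_range] at this
    omega
  rw [Finset.mem_range] at hd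
  set c := padicValNat p (m ^ (p * (p - 1)) - 1) with hc
  set e := padicValNat p a with he
  set g := e - (b + c) with hg
  set u := a / p ^ a.factorization p with hu
  have hau : p ^ e * u = a := by
    rw [he, ← Nat.factorization_def a hp.out]
    exact Nat.ordProj_mul_ordCompl_eq_self a p
  have hpu : ¬ p ∣ u := Nat.not_dvd_ordCompl hp.out ha
  have hu0 : u ≠ 0 := fun h => hpu (h ▸ dvd_zero p)
  have hua : u ∣ a := Dvd.intro_left _ hau
  set P := u.totient / p ^ u.totient.factorization p with hP
  have hphi0 : u.totient ≠ 0 := (Nat.totient_pos.2 (Nat.pos_of_ne_zero hu0)).ne'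
  have hpP : ¬ p ∣ P := Nat.not_dvd_ordCompl hp.out hphi0
  have hP0 : P ≠ 0 := fun h => hpP (h ▸ dvd_zero p)
  -- The exponent is `φ(p ^ 2)`, so that `p ^ 2 ∣ X - 1`.
  set X := m ^ (p * (p - 1)) with hX
  have hs0 : p * (p - 1) ≠ 0 := by
    have := hp.out.two_le
    exact mul_ne_zero (by omega) (by omega)
  have hX1 : 1 < X := Nat.one_lt_pow hs0 (by omega)
  have hXp : p ^ 2 ∣ X - 1 := by
    have h := Nat.ModEq.pow_totient (((hp.out.coprime_iff_not_dvd.2 hpm).symm).pow_right 2)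
    rw [Nat.totient_prime_pow hp.out two_pos] at h
    rw [show 2 - 1 = 1 from rfl, pow_one] at h
    exact (Nat.modEq_iff_dvd' hX1.le).1 h.symm
  set A := X ^ (p ^ g * P) with hA
  have hN0 : p ^ g * P ≠ 0 := mul_ne_zero (pow_ne_zero _ hp.out.ne_zero) hP0
  have hA1 : 1 < A := Nat.one_lt_pow hN0 hX1
  -- The exponent of `A` has valuation exactly `g`, and `c + g = e - b`.
  have hAv : padicValNat p (A - 1) = e - b := by
    rw [hA, padicValNat_pow_sub_one hX1 hXp hN0, padicValNat.mul (pow_ne_zero _ hp.out.ne_zero) hP0,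
      padicValNat.prime_pow, padicValNat.eq_zero_of_not_dvd hpP]
    omega
  have hAp : p ^ 2 ∣ A - 1 := hXp.trans (by simpa using Nat.sub_dvd_pow_sub_pow X 1 (p ^ g * P))
  have huA : u ∣ m ^ a * (A - 1) := by
    rw [hA, hX, ← pow_mul]
    exact dvd_pow_mul_pow_sub_one hu0 hpu (Nat.le_of_dvd (Nat.pos_of_ne_zero ha) hua)
      (fun l hlp hlu => hl l hlp (hlu.trans hua)) _
  set Q := p ^ (e - b) * u with hQ
  have hQ0 : 0 < Q := Nat.pos_of_ne_zero (mul_ne_zero (pow_ne_zero _ hp.out.ne_zero) hu0)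
  have hQa : p ^ b * Q = a := by
    rw [hQ, ← mul_assoc, ← pow_add, Nat.add_sub_cancel' (by omega), hau]
  have hQA : Q ∣ m ^ a * (A - 1) := by
    refine Nat.Coprime.mul_dvd_of_dvd_of_dvd
      ((hp.out.coprime_iff_not_dvd.2 hpu).pow_left _) ?_ huA
    exact Dvd.dvd.mul_left (hAv ▸ pow_padicValNat_dvd) _
  have h1 : ∀ j : ℕ, (Q : ℤ) ∣ (m : ℤ) ^ a * (A : ℤ) ^ j - (m : ℤ) ^ a := by
    intro j
    have h := Int.natCast_dvd_natCast.2 hQA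
    rw [Nat.cast_mul (m ^ a), Nat.cast_sub hA1.le, Nat.cast_pow, Nat.cast_one] at h
    refine h.trans ?_
    rw [show (m : ℤ) ^ a * (A : ℤ) ^ j - (m : ℤ) ^ a = (m : ℤ) ^ a * ((A : ℤ) ^ j - 1 ^ j) by ring]
    exact mul_dvd_mul_left _ (sub_dvd_pow_sub_pow _ _ _)
  -- The valuation of `A ^ (j - i) - 1` is `e - b + v_p(j - i)`, so divisibility by `p ^ e` would
  -- force `p ^ b ∣ j - i`.
  have h2 : ∀ i j : ℕ, i < j → j < p ^ b →
      ¬ ((p ^ b * Q : ℕ) : ℤ) ∣ (m : ℤ) ^ a * (A : ℤ) ^ j - (m : ℤ) ^ a * (A : ℤ) ^ i := by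
    intro i j hij hj hdvd
    have hApow : 1 ≤ A ^ (j - i) := Nat.one_le_pow _ _ (by omega)
    have e1 : (m : ℤ) ^ a * (A : ℤ) ^ j - (m : ℤ) ^ a * (A : ℤ) ^ i =
        ((m ^ a * A ^ i * (A ^ (j - i) - 1) : ℕ) : ℤ) := by
      rw [Nat.cast_mul, Nat.cast_sub hApow]
      push_cast
      rw [mul_sub, mul_assoc, ← pow_add, Nat.add_sub_cancel' hij.le, mul_one]
    rw [e1, Int.natCast_dvd_natCast, hQa] at hdvd
    have hpe : p ^ e ∣ A ^ (j - i) - 1 := by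
      refine Nat.Coprime.dvd_of_dvd_mul_left ?_ ((Dvd.intro _ hau).trans hdvd)
      have hcm : Nat.Coprime p m := hp.out.coprime_iff_not_dvd.2 hpm
      refine Nat.Coprime.pow_left _ (Nat.Coprime.mul_right (hcm.pow_right _) (Nat.Coprime.pow_right _ ?_))
      exact (hcm.pow_right _).pow_right _
    have hne : A ^ (j - i) - 1 ≠ 0 := by
      have := Nat.one_lt_pow (show j - i ≠ 0 by omega) hA1
      omega
    rw [padicValNat_dvd_iff_le hne, padicValNat_pow_sub_one hA1 hAp (by omega), hAv] at hpe
    have : p ^ b ∣ j - i := (padicValNat_dvd_iff_le (by omega)).2 (by omega)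
    have := Nat.le_of_dvd (by omega) this
    omega
  have hm0 : (0 : ℝ) < m := by positivity
  have ha0 : (0 : ℝ) < a := by positivity
  have hr0 : (0 : ℝ) < p ^ b := by have := hp.out.pos; positivity
  have hmr : (m : ℝ) < p ^ b := by exact_mod_cast hb
  have hQa' : (p : ℝ) ^ b * Q = a := by exact_mod_cast hQa
  set y := (m : ℝ) ^ a / a with hy
  -- The least integer with `y + t / p ^ b > d / m`; the mesh `1 / p ^ b < 1 / m` keeps this point
  -- below `(d + 1) / m`.
  set t := ⌊((d : ℝ) / m - y) * p ^ b⌋ + 1 with ht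
  obtain ⟨j, z, hjz⟩ := exists_pow_eq_of_injective (pow_pos hp.out.pos b) h1 h2 t
  have ht1 : ((d : ℝ) / m - y) * p ^ b < t := by
    rw [ht]; push_cast; exact Int.lt_floor_add_one _
  have ht2 : (t : ℝ) ≤ ((d : ℝ) / m - y) * p ^ b + 1 := by
    rw [ht]; push_cast; linarith [Int.floor_le (((d : ℝ) / m - y) * p ^ b)]
  refine orbit_avoids_gap hm hD hmem hd hdD
    (a + p * (p - 1) * (p ^ g * P) * j) z (y := y + t / p ^ b) ?_ ?_ ?_
  · have h : (m : ℝ) ^ a * (A : ℝ) ^ j = (m : ℝ) ^ a + Q * t + p ^ b * Q * z := by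
      exact_mod_cast hjz
    rw [pow_add, pow_mul, pow_mul, show ((m : ℝ) ^ (p * (p - 1))) ^ (p ^ g * P) = (A : ℝ) by
      rw [hA, hX]; push_cast; rfl, h, hy, ← hQa']
    have : (Q : ℝ) ≠ 0 := by positivity
    field_simp
    ring
  · rw [← sub_lt_iff_lt_add', lt_div_iff₀ hr0]
    exact ht1
  · have : (t : ℝ) / p ^ b ≤ (d : ℝ) / m - y + 1 / p ^ b := by
      rw [div_le_iff₀ hr0, add_mul, one_div_mul_cancel hr0.ne']
      exact ht2
    have h3 : 1 / (p : ℝ) ^ b < 1 / m := one_div_lt_one_div_of_lt hm0 hmr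
    rw [add_div]
    linarith

/-! ### Prime divisors and growth of the product -/

/-- With `B = f(1)`, the value `f(1 + B m t)` is `B` times a number congruent to 1 modulo `m`. If
every prime dividing a value divided `m`, that cofactor would be 1 and `f` would be constant. -/
theorem exists_prime_not_dvd_and_dvd_eval {m : ℕ} (hm : 1 ≤ m) {f : Polynomial ℤ}
    (hf : 1 ≤ f.natDegree) (hpos : ∀ k : ℕ, 1 ≤ k → 0 < f.eval (k : ℤ)) :
    ∃ p : ℕ, p.Prime ∧ ¬ p ∣ m ∧ ∃ k : ℕ, 1 ≤ k ∧ (p : ℤ) ∣ f.eval (k : ℤ) := by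
  by_contra! H
  obtain ⟨B, hB⟩ := Int.eq_ofNat_of_zero_le (hpos 1 le_rfl).le
  have hB0 : 0 < B := by have := hpos 1 le_rfl; omega
  have key : ∀ t : ℕ, f.eval ((1 + B * m * t : ℕ) : ℤ) = B := by
    intro t
    have hk := hpos (1 + B * m * t) (by omega)
    have hd : (((1 + B * m * t : ℕ) : ℤ) - (1 : ℕ)) ∣
        f.eval ((1 + B * m * t : ℕ) : ℤ) - f.eval ((1 : ℕ) : ℤ) := f.sub_dvd_eval_sub _ _
    rw [hB] at hd
    obtain ⟨s, hs⟩ := hd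
    have hs' : f.eval ((1 + B * m * t : ℕ) : ℤ) = B * (1 + m * (t * s)) := by
      push_cast at hs ⊢
      linear_combination hs
    have h1 : 0 < 1 + (m : ℤ) * (t * s) := by
      rw [hs'] at hk
      exact pos_of_mul_pos_right hk (by positivity)
    obtain ⟨w, hw⟩ := Int.eq_ofNat_of_zero_le h1.le
    rw [hs', hw]
    by_cases hw1 : w = 1
    · simp [hw1]
    obtain ⟨p, hp, hpw⟩ := Nat.exists_prime_and_dvd hw1
    have hpw' : (p : ℤ) ∣ (w : ℤ) := Int.natCast_dvd_natCast.2 hpw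
    refine absurd ?_ (H p hp ?_ (1 + B * m * t) (by omega))
    · rw [hs', hw]
      exact hpw'.mul_left _
    · intro hpm
      have h2 : (p : ℤ) ∣ 1 := by
        rw [show (1 : ℤ) = w - m * (t * s) by linear_combination hw]
        exact dvd_sub hpw' ((Int.natCast_dvd_natCast.2 hpm).mul_right _)
      exact hp.one_lt.ne' (Nat.dvd_one.1 (by exact_mod_cast h2))
  have hfB : f = Polynomial.C (B : ℤ) := by
    refine Polynomial.eq_of_infinite_eval_eq _ _ ?_
    refine (Set.infinite_range_of_injective
      (f := fun t : ℕ => ((1 + B * m * t : ℕ) : ℤ)) ?_).mono ?_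
    · intro s t hst
      have : 1 + B * m * s = 1 + B * m * t := Int.ofNat_inj.1 hst
      exact Nat.eq_of_mul_eq_mul_left (Nat.mul_pos hB0 hm) (by omega)
    · rintro _ ⟨t, rfl⟩
      simpa using key t
  rw [hfB, Polynomial.natDegree_C] at hf
  omega

theorem exists_eval_le_mul_pow (f : Polynomial ℤ) :
    ∃ S : ℕ, ∀ k n : ℕ, 1 ≤ n → k ≤ n → f.eval (k : ℤ) ≤ S * (n : ℤ) ^ f.natDegree := by
  refine ⟨∑ i ∈ Finset.range (f.natDegree + 1), (f.coeff i).natAbs, fun k n hn hk => ?_⟩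
  rw [Polynomial.eval_eq_sum_range, Nat.cast_sum, Finset.sum_mul]
  refine Finset.sum_le_sum fun i hi => ?_
  have hi' : i ≤ f.natDegree := Nat.lt_succ_iff.1 (Finset.mem_range.1 hi)
  have h1 : (k : ℤ) ^ i ≤ (n : ℤ) ^ f.natDegree := by
    exact_mod_cast (Nat.pow_le_pow_left hk i).trans (Nat.pow_le_pow_right hn hi')
  exact mul_le_mul Int.le_natAbs h1 (by positivity) (by positivity)

theorem exists_mul_pow_le_pow (C d : ℕ) {p : ℕ} (hp : 2 ≤ p) :
    ∃ E₀ : ℕ, ∀ E ≥ E₀, C * (E + 1) ^ d ≤ p ^ E := by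
  have hp' : (1 : ℝ) < p := by exact_mod_cast hp
  have hCp : (0 : ℝ) < 1 / (C * p + 1) := by positivity
  obtain ⟨N, hN⟩ := Filter.eventually_atTop.1
    ((tendsto_pow_const_div_const_pow_of_one_lt d hp').eventually (gt_mem_nhds hCp))
  refine ⟨N, fun E hE => ?_⟩
  have h := hN (E + 1) (by omega)
  rw [div_lt_div_iff₀ (by positivity) (by positivity), one_mul] at h
  have h' : (E + 1) ^ d * (C * p + 1) < p ^ (E + 1) := by exact_mod_cast h
  refine Nat.le_of_mul_le_mul_right (c := p) ?_ (by omega)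
  rw [← pow_succ]
  calc C * (E + 1) ^ d * p = (E + 1) ^ d * (C * p) := by ring
    _ ≤ (E + 1) ^ d * (C * p + 1) := Nat.mul_le_mul_left _ (Nat.le_succ _)
    _ ≤ _ := h'.le

/-- Each of the `E` factors at `k, k + p, k + 2p, …` is divisible by `p`. -/
theorem pow_dvd_polyProd {f : Polynomial ℤ} {p k : ℕ} (hp : 0 < p) (hk : 1 ≤ k)
    (hpk : (p : ℤ) ∣ f.eval (k : ℤ)) {n E : ℕ} (hn : k + p * E ≤ n) :
    (p : ℤ) ^ E ∣ polyProd f n := by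
  have hinj : Set.InjOn (fun i : ℕ => k + p * i) (Finset.range E) := fun i _ j _ h =>
    Nat.eq_of_mul_eq_mul_left hp (Nat.add_left_cancel h)
  have h1 : ∏ _i ∈ Finset.range E, (p : ℤ) ∣
      ∏ i ∈ Finset.range E, f.eval ((k + p * i : ℕ) : ℤ) := by
    refine Finset.prod_dvd_prod_of_dvd _ _ fun i _ => ?_
    have h := f.sub_dvd_eval_sub ((k + p * i : ℕ) : ℤ) (k : ℤ)
    have h2 : (p : ℤ) ∣ ((k + p * i : ℕ) : ℤ) - k := ⟨i, by push_cast; ring⟩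
    exact (dvd_iff_dvd_of_dvd_sub (h2.trans h)).2 hpk
  rw [Finset.prod_const, Finset.card_range] at h1
  refine h1.trans ?_
  rw [← Finset.prod_image (f := fun j : ℕ => f.eval (j : ℤ)) hinj]
  refine Finset.prod_dvd_prod_of_subset _ _ _ fun j hj => ?_
  obtain ⟨i, hi, rfl⟩ := Finset.mem_image.1 hj
  have := Nat.mul_le_mul_left p (Finset.mem_range.1 hi).le
  exact Finset.mem_Icc.2 ⟨by omega, by omega⟩

theorem mainTheorem6 (m : ℕ) (hm : 3 ≤ m) (D : Finset ℕ) (hD : D ⊆ Finset.range m)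
    (hD1 : 1 < D.card) (hDm : D.card < m)
    (f : Polynomial ℤ) (hf : 1 ≤ f.natDegree) (hpos : ∀ k : ℕ, 1 ≤ k → 0 < f.eval (k : ℤ)) :
    ({x : ℝ | ∃ n : ℕ, 1 ≤ n ∧ x = 1 / (polyProd f n : ℝ)} ∩ missingDigitSet m D).Finite := by
  obtain ⟨p, hp, hpm, k, hk, hpk⟩ := exists_prime_not_dvd_and_dvd_eval (m := m) (by omega) hf hpos
  have : Fact p.Prime := ⟨hp⟩
  obtain ⟨S, hS⟩ := exists_eval_le_mul_pow f
  -- The summand `m` serves as the exponent `b`, since `m < p ^ m`.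
  set c := m + padicValNat p (m ^ (p * (p - 1)) - 1) with hc
  obtain ⟨E₀, hE₀⟩ :=
    exists_mul_pow_le_pow ((S + 1) * (k + p) ^ f.natDegree * p ^ c) f.natDegree hp.two_le
  refine ((Set.finite_Iio (k + p * E₀)).image fun n : ℕ => 1 / (polyProd f n : ℝ)).subset ?_
  rintro _ ⟨⟨n, hn, rfl⟩, hmem⟩
  refine ⟨n, ?_, rfl⟩
  by_contra hlt
  rw [Set.mem_Iio, not_lt] at hlt
  set E := (n - k) / p with hE
  have hEn : k + p * E ≤ n := by have := Nat.mul_div_le (n - k) p; rw [← hE] at this; omega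
  have hnE : n ≤ (k + p) * (E + 1) := by
    have := Nat.lt_mul_div_succ (n - k) hp.pos
    rw [← hE] at this
    have := Nat.le_mul_of_pos_right k (show 0 < E + 1 from E.succ_pos)
    rw [add_mul]
    omega
  have hEE : E₀ ≤ E := (Nat.le_div_iff_mul_le hp.pos).2 (by rw [mul_comm]; omega)
  -- This puts the bound `S * n ^ deg f` on prime factors below `p ^ (E - c)`; `S + 1` keeps the
  -- factor positive, which also yields `c ≤ E`.
  have hbig : (S + 1) * n ^ f.natDegree * p ^ c ≤ p ^ E := by
    refine le_trans ?_ (hE₀ E hEE)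
    calc (S + 1) * n ^ f.natDegree * p ^ c
        ≤ (S + 1) * ((k + p) * (E + 1)) ^ f.natDegree * p ^ c := by gcongr
      _ = _ := by rw [mul_pow]; ring
  have hcE : c ≤ E := by
    refine (Nat.pow_le_pow_iff_right hp.one_lt).1 (le_trans ?_ hbig)
    exact Nat.le_mul_of_pos_left _ (by positivity)
  have hprod : 0 < polyProd f n :=
    Finset.prod_pos fun j hj => hpos j (Finset.mem_Icc.1 hj).1
  obtain ⟨a, ha⟩ := Int.eq_ofNat_of_zero_le hprod.le
  have ha0 : a ≠ 0 := by rintro rfl; simp [ha] at hprod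
  have hEa : E ≤ padicValNat p a := by
    rw [← padicValNat_dvd_iff_le ha0]
    have h := pow_dvd_polyProd hp.pos hk hpk hEn
    rw [ha] at h
    exact_mod_cast h
  rw [ha, Int.cast_natCast] at hmem
  refine one_div_notMem_missingDigitSet (by omega) hD hDm hpm ha0 (Nat.lt_pow_self hp.one_lt)
    (hcE.trans hEa) (fun l hl hla => ?_) hmem
  rw [← hc]
  have hla' : (l : ℤ) ∣ polyProd f n := ha ▸ Int.natCast_dvd_natCast.2 hla
  obtain ⟨j, hj, hlj⟩ := (Nat.prime_iff_prime_int.1 hl).exists_mem_finset_dvd hla'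
  obtain ⟨hj1, hjn⟩ := Finset.mem_Icc.1 hj
  have h1 : (l : ℤ) ≤ S * (n : ℤ) ^ f.natDegree :=
    (Int.le_of_dvd (hpos j hj1) hlj).trans (hS j n hn hjn)
  have h2 : l ≤ S * n ^ f.natDegree := by exact_mod_cast h1
  have h3 : l * p ^ c ≤ p ^ (E - c) * p ^ c := by
    rw [← pow_add, Nat.sub_add_cancel hcE]
    refine le_trans ?_ hbig
    exact Nat.mul_le_mul_right _ (h2.trans (Nat.mul_le_mul_right _ (Nat.le_succ S)))
  exact (Nat.le_of_mul_le_mul_right h3 (pow_pos hp.pos c)).trans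
    (Nat.pow_le_pow_right hp.pos (Nat.sub_le_sub_right hEa c))
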